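/- \textbf{Notation.} All spaces carry the Euclidean norm. For $C\subseteq\mathbb R^s$ and $y\in C$, the tangent cone is \[T_C(y)=\{u : \exists\, t_k\downarrow 0,\ u_k\to u \text{ with } y+t_ku_k\in C\ \forall k\},\] and the regular normal cone is $\widehat N_C(y)=\{v : \langle v,y'-y\rangle\le o(\|y'-y\|)\ \text{for } y'\in C\}$, with $\widehat N_C(y)=\emptyset$ if $y\notin C$. For a direction $d\in\mathbb R^s$, the directional limiting normal cone is \[N_C(y;d)=\{v : \exists\, t_k\downarrow 0,\ d_k\to d,\ v_k\to v \text{ with } v_k\in\widehat N_C(y+t_kd_k)\ \forall k\},\] and the inner directional limiting normal cone is \[N^i_C(y;d)=\{v : \forall\, t_k\downarrow 0\ \exists\, d_k\to d,\ v_k\to v \text{ with } v_k\in\widehat N_C(y+t_kd_k)\ \forall k\}.\] Here $t_k\downarrow0$ means $t_k>0$ and $t_k\to0$. The set $C$ is directionally regular at $y$ if $N_C(y;d)=N^i_C(y;d)$ for all $d$. For a map $P$ and a closed set $D$ with $P(z^*)\in D$, the set-valued map $M(z)=P(z)-D$ is metrically subregular at $(z^*,0)$ if there are $\kappa>0$ and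 a neighborhood $V$ of $z^*$ such that $d(z,M^{-1}(0))\le\kappa\, d(P(z),D)$ for all $z\in V$, where $M^{-1}(0)=\{z: P(z)\in D\}$. \textbf{Theorem.} Let $I\ge 1$, let $P_i:\mathbb R^n\to\mathbb R^{s_i}$ be continuously differentiable and $D_i\subseteq\mathbb R^{s_i}$ closed, $i=1,\dots,I$. Put $P(z)=(P_1(z),\dots,P_I(z))$ and $D=D_1\times\dots\times D_I$, and let $P(z^*)\in D$. Consider the following two conditions. (A) For every $w\neq0$ with $\nabla P_i(z^*)w\in T_{D_i}(P_i(z^*))$ for all $i=1,\dots,I$, and all $\lambda^i\in\mathbb R^{s_i}$: \[\nabla P_1(z^*)^T\lambda^1+\sum_{i=2}^I\nabla P_i(z^*)^T\lambda^i=0,\quad \lambda^i\in N_{D_i}(P_i(z^*);\nabla P_i(z^*)w)\ \ (i=1,\dots,I)\] implies $\lambda^i=0$ for all $i=2,\dots,I$. (B) For every $w\ne0$ with $\nabla P(z^*)w\in T_D(P(z^*))$ and all $\lambda^i\in\mathbb R^{s_i}$: \[\nabla P_1(z^*)^T\lambda^1+\sum_{i=2}^I\nabla P_i(z^*)^T\lambda^i=0,\quad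 \lambda^1\in N_{D_1}(P_1(z^*);\nabla P_1(z^*)w),\] \[(\lambda^2,\dots,\lambda^I)\in N_{D_2\times\dots\times D_I}\big((P_2(z^*),\dots,P_I(z^*));(\nabla P_2(z^*)w,\dots,\nabla P_I(z^*)w)\big)\] implies $\lambda^i=0$ for all $i=2,\dots,I$. 1. If $M_1(z)=P_1(z)-D_1$ is metrically subregular at $(z^*,0)$ and (A) holds, then $M(z)=P(z)-D$ is metrically subregular at $(z^*,0)$. 2. If $D_i$ is directionally regular at $P_i(z^*)$ for $i=2,\dots,I$, then (A) and (B) are equivalent. -/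

import Mathlib

open Filter Topology

section Cones

variable {E : Type*} [NormedAddCommGroup E] [InnerProductSpace ℝ E]

/-- The (Bouligand) tangent cone `T_C(z)`: all limits `u` of vectors `u_k` such that
`z + t_k u_k ∈ C` for some `t_k ↓ 0`. -/
def bouligandTangentCone (C : Set E) (z : E) : Set E :=
  {u | ∃ (t : ℕ → ℝ) (v : ℕ → E), (∀ k, 0 < t k) ∧ Tendsto t atTop (𝓝 0) ∧
    Tendsto v atTop (𝓝 u) ∧ ∀ k, z + t k • v k ∈ C}

/-- The regular (Fréchet) normal cone: all `v` with `⟨v, z' - z⟩ ≤ o(‖z' - z‖)` for `z' ∈ C`.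
It is empty if `z ∉ C`. -/
def regularNormalCone (C : Set E) (z : E) : Set E :=
  {v | z ∈ C ∧ ∀ ε : ℝ, 0 < ε → ∀ᶠ z' in 𝓝[C] z, inner ℝ v (z' - z) ≤ ε * ‖z' - z‖}

/-- The limiting normal cone `N_C(z; d)` to `C` at `z` in direction `d`. -/
def directionalNormalCone (C : Set E) (z d : E) : Set E :=
  {v | ∃ (t : ℕ → ℝ) (dk vk : ℕ → E), (∀ k, 0 < t k) ∧ Tendsto t atTop (𝓝 0) ∧
    Tendsto dk atTop (𝓝 d) ∧ Tendsto vk atTop (𝓝 v) ∧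
    ∀ k, vk k ∈ regularNormalCone C (z + t k • dk k)}

/-- The inner limiting normal cone to `C` at `z` in direction `d`: here every sequence
`t_k ↓ 0` has to admit suitable `d_k → d` and `v_k → v`. -/
def innerDirectionalNormalCone (C : Set E) (z d : E) : Set E :=
  {v | ∀ t : ℕ → ℝ, (∀ k, 0 < t k) → Tendsto t atTop (𝓝 0) →
    ∃ dk vk : ℕ → E, Tendsto dk atTop (𝓝 d) ∧ Tendsto vk atTop (𝓝 v) ∧
      ∀ k, vk k ∈ regularNormalCone C (z + t k • dk k)}

/-- `C` is directionally regular at `z`: in every direction, the limiting normal cone and the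
inner limiting normal cone agree. -/
def DirectionallyRegularAt (C : Set E) (z : E) : Prop :=
  ∀ d : E, directionalNormalCone C z d = innerDirectionalNormalCone C z d

end Cones

/-- Metric subregularity at `(z, 0)` of the set-valued map `M(x) = P(x) - D`. Here
`M⁻¹(0) = {x | P x ∈ D}`, and `(z, 0)` belongs to the graph of `M` when `P z ∈ D`. -/
def ConstraintMetricallySubregular {X Y : Type*} [PseudoMetricSpace X] [PseudoMetricSpace Y]
    (P : X → Y) (D : Set Y) (z : X) : Prop :=
  P z ∈ D ∧ ∃ κ : ℝ, 0 < κ ∧ ∃ V ∈ 𝓝 z, ∀ x ∈ V,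
    Metric.infDist x {y | P y ∈ D} ≤ κ * Metric.infDist (P x) D

/-- The Cartesian product of the sets `D i`, in the Euclidean (`ℓ²`) product space. -/
def euclideanPi {ι : Type*} {F : ι → Type*} (D : ∀ i, Set (F i)) : Set (PiLp 2 F) :=
  {y | ∀ i, y i ∈ D i}

/-- The map `z ↦ (P i z)_i` into the Euclidean (`ℓ²`) product space. -/
def jointMap {ι X : Type*} {F : ι → Type*} (P : ∀ i, X → F i) (z : X) : PiLp 2 F :=
  WithLp.toLp 2 (fun i => P i z)

section Conditions

variable {n m : ℕ} {s : Fin (m + 1) → ℕ}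

/-- The multiplier condition with blockwise cones. The block `0` plays the role of the first
block, the blocks `i.succ` that of the remaining ones; `∇P_iᵀ` is the adjoint of the derivative. -/
def BlockwiseMultiplierCondition
    (P : ∀ i, EuclideanSpace ℝ (Fin n) → EuclideanSpace ℝ (Fin (s i)))
    (D : ∀ i, Set (EuclideanSpace ℝ (Fin (s i)))) (z : EuclideanSpace ℝ (Fin n)) : Prop :=
  ∀ w : EuclideanSpace ℝ (Fin n), w ≠ 0 →
    (∀ i, fderiv ℝ (P i) z w ∈ bouligandTangentCone (D i) (P i z)) →
    ∀ l : ∀ i, EuclideanSpace ℝ (Fin (s i)),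
      (fderiv ℝ (P 0) z).adjoint (l 0)
        + ∑ i : Fin m, (fderiv ℝ (P i.succ) z).adjoint (l i.succ) = 0 →
      (∀ i, l i ∈ directionalNormalCone (D i) (P i z) (fderiv ℝ (P i) z w)) →
      ∀ i : Fin m, l i.succ = 0

/-- The multiplier condition with the tangent cone to the whole product, and the directional
normal cone to the product of all blocks but the first. -/
def JointMultiplierCondition
    (P : ∀ i, EuclideanSpace ℝ (Fin n) → EuclideanSpace ℝ (Fin (s i)))
    (D : ∀ i, Set (EuclideanSpace ℝ (Fin (s i)))) (z : EuclideanSpace ℝ (Fin n)) : Prop :=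
  ∀ w : EuclideanSpace ℝ (Fin n), w ≠ 0 →
    fderiv ℝ (jointMap P) z w ∈ bouligandTangentCone (euclideanPi D) (jointMap P z) →
    ∀ l : ∀ i, EuclideanSpace ℝ (Fin (s i)),
      (fderiv ℝ (P 0) z).adjoint (l 0)
        + ∑ i : Fin m, (fderiv ℝ (P i.succ) z).adjoint (l i.succ) = 0 →
      l 0 ∈ directionalNormalCone (D 0) (P 0 z) (fderiv ℝ (P 0) z w) →
      (WithLp.toLp 2 (fun i : Fin m => l i.succ) :
          PiLp 2 (fun i : Fin m => EuclideanSpace ℝ (Fin (s i.succ)))) ∈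
        directionalNormalCone (euclideanPi (fun i : Fin m => D i.succ))
          (WithLp.toLp 2 (fun i : Fin m => P i.succ z))
          (WithLp.toLp 2 (fun i : Fin m => fderiv ℝ (P i.succ) z w)) →
      ∀ i : Fin m, l i.succ = 0

end Conditions

/-! ### Regular and directional normals to a single set. -/

section NormalCones

variable {E : Type*} [NormedAddCommGroup E] [InnerProductSpace ℝ E]

/-! Part 1 is a penalty argument by contradiction. Write `f = P₁` and let `g` collect the other
blocks. If subregularity fails, some `x₀` near `z` with `f x₀ ∈ C` has `g`-residual tiny relative to
its distance `Δ` from the feasible set. Minimizing `d(g u, D) + N d(f u, C)² + ρ‖u - x₀‖²` near `x₀`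
gives a point with almost stationary multipliers (`exists_penalty_multipliers`). The `g`-multiplier
has norm one because the distance to `D` enters unsquared. Subregularity of `f` bounds the
`f`-multiplier, by comparison with a nearest point of `f⁻¹(C)`. Letting `ε → 0`, compactness yields
a direction `w ≠ 0` and exact multipliers with nonzero `g`-part, against (A).

In Part 2, directional normals to a product share one sequence `t_k`, whereas blockwise normals may
each use their own. Inner normals accept any prescribed sequence, so regularity of all blocks but
the first lets them follow the sequence of the first. -/

theorem smul_sub_mem_regularNormalCone {C : Set E} {x y : E} (hy : y ∈ C)
    (h : Metric.infDist x C = dist x y) {c : ℝ} (hc : 0 ≤ c) :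
    c • (x - y) ∈ regularNormalCone C y := by
  refine ⟨hy, fun ε hε => ?_⟩
  -- The nearest-point property gives `⟨x - y, y' - y⟩ ≤ ‖y' - y‖² / 2`, so `c ‖y' - y‖ ≤ 2ε`
  -- suffices; `c + 1` covers `c = 0`.
  have hball : Metric.ball y (2 * ε / (c + 1)) ∈ 𝓝 y := Metric.ball_mem_nhds _ (by positivity)
  filter_upwards [mem_nhdsWithin_of_mem_nhds hball, self_mem_nhdsWithin] with y' hy' hy'C
  have h1 : ‖x - y‖ ≤ ‖x - y'‖ := by
    rw [← dist_eq_norm, ← dist_eq_norm, ← h]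
    exact Metric.infDist_le_dist_of_mem hy'C
  have h2 : ‖x - y'‖ ^ 2 = ‖x - y‖ ^ 2 - 2 * inner ℝ (x - y) (y' - y) + ‖y' - y‖ ^ 2 := by
    rw [← norm_sub_sq_real]
    congr 2
    abel
  have h3 : inner ℝ (x - y) (y' - y) ≤ ‖y' - y‖ ^ 2 / 2 := by
    have := pow_le_pow_left₀ (norm_nonneg _) h1 2
    linarith
  have h4 : ‖y' - y‖ * (c + 1) ≤ 2 * ε := by
    rw [Metric.mem_ball, dist_eq_norm, lt_div_iff₀ (by positivity)] at hy'
    exact hy'.le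
  rw [real_inner_smul_left]
  have h5 : c * ‖y' - y‖ ≤ 2 * ε := by nlinarith [norm_nonneg (y' - y)]
  calc c * inner ℝ (x - y) (y' - y) ≤ c * (‖y' - y‖ ^ 2 / 2) := by gcongr
    _ = c * ‖y' - y‖ * ‖y' - y‖ / 2 := by ring
    _ ≤ 2 * ε * ‖y' - y‖ / 2 := by gcongr
    _ = ε * ‖y' - y‖ := by ring

/-- Regular normals exist only at points of `C`. The tangency requirement in (A) thus follows from
the normal cone memberships. -/
theorem mem_bouligandTangentCone_of_mem_directionalNormalCone {C : Set E} {z d v : E}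
    (h : v ∈ directionalNormalCone C z d) : d ∈ bouligandTangentCone C z := by
  obtain ⟨t, dk, vk, ht, ht0, hd, -, hv⟩ := h
  exact ⟨t, dk, ht, ht0, hd, fun k => (hv k).1⟩

end NormalCones

/-! ### Cones and distances for product sets. -/

section Products

variable {ι : Type*} {F : ι → Type*} [∀ i, NormedAddCommGroup (F i)]

theorem tendsto_piLp_iff {α : Type*} {l : Filter α} {u : α → PiLp 2 F} {a : PiLp 2 F} :
    Tendsto u l (𝓝 a) ↔ ∀ i, Tendsto (fun k => u k i) l (𝓝 (a i)) := by
  rw [(PiLp.homeomorph 2 F).isInducing.tendsto_nhds_iff, tendsto_pi_nhds]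
  rfl

theorem isClosed_euclideanPi {D : ∀ i, Set (F i)} (hD : ∀ i, IsClosed (D i)) :
    IsClosed (euclideanPi D) := by
  have : euclideanPi D = ⋂ i, (fun y : PiLp 2 F => y i) ⁻¹' D i := by
    ext y
    simp [euclideanPi]
  rw [this]
  exact isClosed_iInter fun i => (hD i).preimage (PiLp.continuous_apply 2 F i)

theorem infDist_apply_le_infDist_euclideanPi [Fintype ι] {D : ∀ i, Set (F i)}
    (hD : (euclideanPi D).Nonempty)
    (y : PiLp 2 F) (i : ι) : Metric.infDist (y i) (D i) ≤ Metric.infDist y (euclideanPi D) := by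
  refine (Metric.le_infDist hD).2 fun y' hy' => ?_
  refine (Metric.infDist_le_dist_of_mem (hy' i)).trans ?_
  rw [dist_eq_norm, dist_eq_norm]
  exact PiLp.norm_apply_le (y - y') i

variable [Fintype ι] [∀ i, InnerProductSpace ℝ (F i)]

theorem bouligandTangentCone_euclideanPi_subset {D : ∀ i, Set (F i)} {y d : PiLp 2 F}
    (h : d ∈ bouligandTangentCone (euclideanPi D) y) (i : ι) :
    d i ∈ bouligandTangentCone (D i) (y i) := by
  obtain ⟨t, v, ht, ht0, hv, hm⟩ := h
  exact ⟨t, fun k => v k i, ht, ht0, tendsto_piLp_iff.1 hv i, fun k => hm k i⟩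

theorem mem_regularNormalCone_euclideanPi {D : ∀ i, Set (F i)} {y v : PiLp 2 F} :
    v ∈ regularNormalCone (euclideanPi D) y ↔ ∀ i, v i ∈ regularNormalCone (D i) (y i) := by
  classical
  constructor
  · rintro ⟨hy, h⟩ i
    refine ⟨hy i, fun ε hε => ?_⟩
    -- Vary only the `i`-th coordinate: this curve stays in the product and isolates the `i`-th
    -- inner product.
    let e : F i → PiLp 2 F := fun x => y + PiLp.single 2 i (x - y i)
    have hei : ∀ x, e x i = x := fun x => by simp [e]
    have hej : ∀ x j, j ≠ i → e x j = y j := fun x j hj => by simp [e, hj]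
    have he0 : e (y i) = y := by simp [e]
    have hcont : Tendsto e (𝓝[D i] (y i)) (𝓝[euclideanPi D] y) := by
      refine tendsto_nhdsWithin_iff.2 ⟨tendsto_piLp_iff.2 fun j => ?_, ?_⟩
      · by_cases hj : j = i
        · subst hj
          simp only [hei]
          exact tendsto_id.mono_left nhdsWithin_le_nhds
        · simp only [hej _ j hj]
          exact tendsto_const_nhds
      · filter_upwards [self_mem_nhdsWithin] with x hx j
        by_cases hj : j = i
        · subst hj
          rwa [hei]
        · rw [hej x j hj]
          exact hy j
    filter_upwards [hcont.eventually (h ε hε)] with x hx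
    have h1 : e x - y = PiLp.single 2 i (x - y i) := by simp [e]
    rw [h1, PiLp.norm_single] at hx
    have h2 : inner ℝ v (PiLp.single 2 i (x - y i)) = inner ℝ (v i) (x - y i) := by
      rw [PiLp.inner_apply, Finset.sum_eq_single i]
      · simp
      · intro j _ hj
        simp [hj]
      · simp
    rwa [h2] at hx
  · intro h
    refine ⟨fun i => (h i).1, fun ε hε => ?_⟩
    have hc : (0 : ℝ) < Fintype.card ι + 1 := by positivity
    have key : ∀ i, ∀ᶠ y' in 𝓝[euclideanPi D] y,
        inner ℝ (v i) (y' i - y i) ≤ ε / (Fintype.card ι + 1) * ‖y' i - y i‖ := fun i => by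
      have hcont : Tendsto (fun y' : PiLp 2 F => y' i) (𝓝[euclideanPi D] y) (𝓝[D i] (y i)) := by
        refine tendsto_nhdsWithin_iff.2
          ⟨((PiLp.continuous_apply 2 F i).tendsto y).mono_left nhdsWithin_le_nhds, ?_⟩
        filter_upwards [self_mem_nhdsWithin] with y' hy' using hy' i
      exact hcont.eventually ((h i).2 _ (by positivity))
    filter_upwards [eventually_all.2 key] with y' hy'
    rw [PiLp.inner_apply]
    calc ∑ i, inner ℝ (v i) ((y' - y) i)
        ≤ ∑ _i : ι, ε / (Fintype.card ι + 1) * ‖y' - y‖ := by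
          refine Finset.sum_le_sum fun i _ => (hy' i).trans ?_
          gcongr
          exact PiLp.norm_apply_le (y' - y) i
      _ = Fintype.card ι * (ε / (Fintype.card ι + 1)) * ‖y' - y‖ := by
          simp [mul_assoc]
      _ ≤ ε * ‖y' - y‖ := by
          gcongr
          rw [mul_div_assoc', div_le_iff₀ hc]
          nlinarith

/-- Only this inclusion is general: conversely, the blocks would need a common sequence `t_k`. -/
theorem directionalNormalCone_euclideanPi_subset {D : ∀ i, Set (F i)} {y d v : PiLp 2 F}
    (h : v ∈ directionalNormalCone (euclideanPi D) y d) (i : ι) :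
    v i ∈ directionalNormalCone (D i) (y i) (d i) := by
  obtain ⟨t, dk, vk, ht, ht0, hd, hv, hm⟩ := h
  exact ⟨t, fun k => dk k i, fun k => vk k i, ht, ht0, tendsto_piLp_iff.1 hd i,
    tendsto_piLp_iff.1 hv i, fun k => mem_regularNormalCone_euclideanPi.1 (hm k) i⟩

end Products

theorem infDist_tail_le_infDist_euclideanPi {m : ℕ} {F : Fin (m + 1) → Type*}
    [∀ i, NormedAddCommGroup (F i)] {D : ∀ i, Set (F i)} (hD : (euclideanPi D).Nonempty)
    (y : PiLp 2 F) :
    Metric.infDist (WithLp.toLp 2 (fun i : Fin m => y i.succ) : PiLp 2 fun i : Fin m => F i.succ)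
      (euclideanPi fun i : Fin m => D i.succ) ≤ Metric.infDist y (euclideanPi D) := by
  refine (Metric.le_infDist hD).2 fun y' hy' => ?_
  refine (Metric.infDist_le_dist_of_mem
    (show (WithLp.toLp 2 (fun i : Fin m => y' i.succ) : PiLp 2 fun i : Fin m => F i.succ) ∈
      euclideanPi fun i : Fin m => D i.succ from fun i => hy' i.succ)).trans ?_
  rw [PiLp.dist_eq_of_L2, PiLp.dist_eq_of_L2, Fin.sum_univ_succ]
  exact Real.sqrt_le_sqrt (le_add_of_nonneg_left (by positivity))

/-! ### Derivative and adjoint of the joint map. -/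

section JointMap

variable {ι X : Type*} [Fintype ι] {F : ι → Type*} [∀ i, NormedAddCommGroup (F i)]
  [∀ i, InnerProductSpace ℝ (F i)] [NormedAddCommGroup X] [InnerProductSpace ℝ X]

theorem contDiff_jointMap {P : ∀ i, X → F i} (hP : ∀ i, ContDiff ℝ 1 (P i)) :
    ContDiff ℝ 1 (jointMap P) :=
  (contDiff_piLp 2).2 hP

theorem fderiv_jointMap_apply {P : ∀ i, X → F i} (hP : ∀ i, ContDiff ℝ 1 (P i)) (z w : X)
    (i : ι) : fderiv ℝ (jointMap P) z w i = fderiv ℝ (P i) z w := by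
  have h1 := ((contDiff_jointMap hP).differentiable one_ne_zero z).hasFDerivAt
  have h2 := (PiLp.proj (𝕜 := ℝ) 2 F i).hasFDerivAt.comp z h1
  have h3 := h2.unique (((hP i).differentiable one_ne_zero z).hasFDerivAt)
  exact congrArg (fun A : X →L[ℝ] F i => A w) h3

theorem adjoint_fderiv_jointMap [FiniteDimensional ℝ X] [∀ i, FiniteDimensional ℝ (F i)]
    {P : ∀ i, X → F i} (hP : ∀ i, ContDiff ℝ 1 (P i)) (z : X) (l : PiLp 2 F) :
    (fderiv ℝ (jointMap P) z).adjoint l = ∑ i, (fderiv ℝ (P i) z).adjoint (l i) := by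
  refine ext_inner_right ℝ fun w => ?_
  simp only [ContinuousLinearMap.adjoint_inner_left, sum_inner, PiLp.inner_apply,
    fderiv_jointMap_apply hP]

end JointMap

/-! ### Equivalence of the two multiplier conditions. -/

theorem multiplierCondition_iff {n m : ℕ} {s : Fin (m + 1) → ℕ}
    {P : ∀ i, EuclideanSpace ℝ (Fin n) → EuclideanSpace ℝ (Fin (s i))}
    {D : ∀ i, Set (EuclideanSpace ℝ (Fin (s i)))} {z : EuclideanSpace ℝ (Fin n)}
    (hP : ∀ i, ContDiff ℝ 1 (P i))
    (hreg : ∀ i : Fin m, DirectionallyRegularAt (D i.succ) (P i.succ z)) :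
    BlockwiseMultiplierCondition P D z ↔ JointMultiplierCondition P D z := by
  constructor
  · intro h w hw hT l hl h0 hN
    refine h w hw (fun i => ?_) l hl fun i => ?_
    · rw [← fderiv_jointMap_apply hP]
      exact bouligandTangentCone_euclideanPi_subset hT i
    · refine Fin.cases h0 (fun j => ?_) i
      exact directionalNormalCone_euclideanPi_subset hN j
  · intro h w hw _ l hl hN
    obtain ⟨t, d0, v0, ht, ht0, hd0, hv0, hm0⟩ := hN 0
    have hin : ∀ i : Fin m, ∃ dk vk : ℕ → EuclideanSpace ℝ (Fin (s i.succ)),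
        Tendsto dk atTop (𝓝 (fderiv ℝ (P i.succ) z w)) ∧ Tendsto vk atTop (𝓝 (l i.succ)) ∧
        ∀ k, vk k ∈ regularNormalCone (D i.succ) (P i.succ z + t k • dk k) := fun i => by
      have := hN i.succ
      rw [hreg i] at this
      exact this t ht ht0
    choose dk vk hd hv hm using hin
    -- The sequence `t` of block `0` serves all blocks, for tangency as well as for normals.
    refine h w hw ⟨t, fun k => WithLp.toLp 2 (Fin.cons (d0 k) fun i => dk i k), ht, ht0, ?_, ?_⟩
      l hl (hN 0) ⟨t, fun k => WithLp.toLp 2 fun i => dk i k,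
        fun k => WithLp.toLp 2 fun i => vk i k, ht, ht0, ?_, ?_, ?_⟩
    · refine tendsto_piLp_iff.2 fun i => ?_
      rw [fderiv_jointMap_apply hP]
      refine Fin.cases hd0 (fun j => ?_) i
      exact hd j
    · intro k i
      refine Fin.cases (hm0 k).1 (fun j => ?_) i
      exact (hm j k).1
    · exact tendsto_piLp_iff.2 hd
    · exact tendsto_piLp_iff.2 hv
    · exact fun k => mem_regularNormalCone_euclideanPi.2 fun i => hm i k

/-! ### Penalization and approximate multipliers. -/

section Subregularity

variable {E F G : Type*} [NormedAddCommGroup E] [InnerProductSpace ℝ E] [FiniteDimensional ℝ E]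
  [NormedAddCommGroup F] [InnerProductSpace ℝ F] [FiniteDimensional ℝ F]
  [NormedAddCommGroup G] [InnerProductSpace ℝ G] [FiniteDimensional ℝ G]

/-- First-order condition at a local minimizer of a sum of weighted squares. -/
theorem adjoint_add_adjoint_eq_of_isLocalMin {f : E → F} {g : E → G} {x x₀ : E}
    (hf : DifferentiableAt ℝ f x) (hg : DifferentiableAt ℝ g x) {y₁ : F} {y₂ : G} {a b c : ℝ}
    (h : IsLocalMin (fun u => a * ‖f u - y₁‖ ^ 2 + b * ‖g u - y₂‖ ^ 2 + c * ‖u - x₀‖ ^ 2) x) :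
    (fderiv ℝ f x).adjoint ((2 * a) • (f x - y₁)) + (fderiv ℝ g x).adjoint ((2 * b) • (g x - y₂))
      = -((2 * c) • (x - x₀)) := by
  have h1 := ((hf.hasFDerivAt.sub_const y₁).norm_sq.const_mul a).add
    ((hg.hasFDerivAt.sub_const y₂).norm_sq.const_mul b)
  have h2 := h1.add (((hasFDerivAt_id (𝕜 := ℝ) x).sub_const x₀).norm_sq.const_mul c)
  have h3 := h.hasFDerivAt_eq_zero h2
  refine ext_inner_right ℝ fun v => ?_
  have h4 := congrArg (fun A : E →L[ℝ] ℝ => A v) h3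
  simp at h4
  simp only [inner_add_left, inner_neg_left, ContinuousLinearMap.adjoint_inner_left,
    real_inner_smul_left, inner_sub_left]
  linarith

/-- Penalization: at a minimizer of the penalized distance there are approximate multipliers. -/
theorem exists_penalty_multipliers {f : E → F} {g : E → G} {C : Set F} {D : Set G}
    (hf : ContDiff ℝ 1 f) (hg : ContDiff ℝ 1 g) (hC : IsClosed C) (hD : IsClosed D)
    {κ L : ℝ} (hκ : 0 < κ) (hL : 0 ≤ L) {V : Set E}
    (hsub : ∀ x ∈ V, Metric.infDist x {u | f u ∈ C} ≤ κ * Metric.infDist (f x) C)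
    (hlip : ∀ x ∈ V, ∀ y ∈ V, dist (g x) (g y) ≤ L * dist x y)
    {x₀ : E} {Δ ε : ℝ} (hε : 0 < ε) (hε' : ε ≤ 1 / 4) (hx₀ : f x₀ ∈ C) (hDne : D.Nonempty)
    (hV : Metric.closedBall x₀ Δ ⊆ V) (hΔ : 0 < Δ)
    (hempty : ∀ u, dist u x₀ < Δ → ¬ (f u ∈ C ∧ g u ∈ D))
    (hsmall : Metric.infDist (g x₀) D ≤ ε ^ 2 * Δ) :
    ∃ (x : E) (y₁ : F) (y₂ : G) (l₁ : F) (l₂ : G), ‖x - x₀‖ ≤ ε * Δ ∧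
      l₁ ∈ regularNormalCone C y₁ ∧ l₂ ∈ regularNormalCone D y₂ ∧
      ‖l₂‖ = 1 ∧ ‖l₁‖ ≤ 2 * ((L + 3) * κ) ∧
      ‖f x - y₁‖ ≤ ε ^ 2 * Δ ∧ ‖g x - y₂‖ ≤ ε ^ 2 * Δ ∧
      ‖(fderiv ℝ f x).adjoint l₁ + (fderiv ℝ g x).adjoint l₂‖ ≤ 2 * ε := by
  have hCne : C.Nonempty := ⟨_, hx₀⟩
  set δ := Metric.infDist (g x₀) D with hδ_def
  have hδ : 0 < δ := (hD.notMem_iff_infDist_pos hDne).1 fun h =>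
    hempty x₀ (by simpa using hΔ) ⟨hx₀, h⟩
  -- With `ρ = ε / R` below, `ρR² = δ` confines the minimizer to radius `R`, and the proximal
  -- gradient `2ρR` is only `2ε`.
  set R := δ / ε with hR_def
  have hR : 0 < R := by positivity
  have hRε : R * ε = δ := by rw [hR_def]; field_simp
  have hRΔ : R ≤ ε * Δ := by
    rw [hR_def, div_le_iff₀ hε]; linarith
  have h2R : 2 * R < Δ := by nlinarith
  set A : E → ℝ := fun u => Metric.infDist (f u) C with hA
  set B : E → ℝ := fun u => Metric.infDist (g u) D with hB
  have hAc : Continuous A := (Metric.continuous_infDist_pt C).comp hf.continuous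
  have hBc : Continuous B := (Metric.continuous_infDist_pt D).comp hg.continuous
  have hA0 : ∀ u, 0 ≤ A u := fun u => Metric.infDist_nonneg
  have hB0 : ∀ u, 0 ≤ B u := fun u => Metric.infDist_nonneg
  have hK : IsCompact (Metric.closedBall x₀ (2 * R)) := isCompact_closedBall _ _
  have hKne : (Metric.closedBall x₀ (2 * R)).Nonempty := ⟨x₀, by simp [hR.le]⟩
  obtain ⟨μ, hμ, hμle⟩ : ∃ μ : ℝ, 0 < μ ∧ ∀ u ∈ Metric.closedBall x₀ (2 * R), μ ≤ A u + B u := by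
    obtain ⟨u, hu, hmin⟩ := hK.exists_isMinOn hKne (hAc.add hBc).continuousOn
    refine ⟨A u + B u, ?_, fun v hv => hmin hv⟩
    by_contra hle
    have h1 := hA0 u
    have h2 := hB0 u
    refine hempty u ((Metric.mem_closedBall.1 hu).trans_lt h2R)
      ⟨(hC.mem_iff_infDist_zero hCne).2 ?_, (hD.mem_iff_infDist_zero hDne).2 ?_⟩
    · change A u = 0
      linarith
    · change B u = 0
      linarith
  -- The weight `N = δ / θ²` forces `A x ≤ θ`. Then `κθ ≤ R` keeps the nearest feasible point in the
  -- ball, `θ ≤ δ` bounds the `f`-residual, and `θ < μ` makes `B x` positive.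
  obtain ⟨θ, hθ, hθR, hθδ, hθμ⟩ : ∃ θ : ℝ, 0 < θ ∧ κ * θ ≤ R ∧ θ ≤ δ ∧ θ < μ := by
    refine ⟨min (R / κ) (min δ (μ / 2)), by positivity, ?_, ?_, ?_⟩
    · calc κ * min (R / κ) (min δ (μ / 2)) ≤ κ * (R / κ) := by gcongr; exact min_le_left _ _
        _ = R := by field_simp
    · exact (min_le_right _ _).trans (min_le_left _ _)
    · exact ((min_le_right _ _).trans (min_le_right _ _)).trans_lt (by linarith)
  set N := δ / θ ^ 2 with hN_def
  have hN : 0 < N := by positivity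
  have hNθ : N * θ ^ 2 = δ := by rw [hN_def]; field_simp
  set ρ := ε / R with hρ_def
  have hρ : 0 < ρ := by positivity
  have hρR : ρ * R = ε := by rw [hρ_def]; field_simp
  obtain ⟨x, hxK, hxmin⟩ := hK.exists_isMinOn hKne
    (f := fun u => B u + N * A u ^ 2 + ρ * ‖u - x₀‖ ^ 2) (by fun_prop)
  have hmin : ∀ u ∈ Metric.closedBall x₀ (2 * R),
      B x + N * A x ^ 2 + ρ * ‖x - x₀‖ ^ 2 ≤ B u + N * A u ^ 2 + ρ * ‖u - x₀‖ ^ 2 :=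
    fun u hu => hxmin hu
  have hx0 : B x + N * A x ^ 2 + ρ * ‖x - x₀‖ ^ 2 ≤ δ := by
    have h1 := hmin x₀ (by simp [hR.le])
    have h2 : A x₀ = 0 := Metric.infDist_zero_of_mem hx₀
    simpa [h2] using h1
  have hNA : 0 ≤ N * A x ^ 2 := by positivity
  have hρx : 0 ≤ ρ * ‖x - x₀‖ ^ 2 := by positivity
  have hBδ : B x ≤ δ := by linarith [hB0 x]
  have hAθ : A x ≤ θ := by
    refine le_of_sq_le_sq ?_ hθ.le
    have : N * A x ^ 2 ≤ N * θ ^ 2 := by linarith [hB0 x]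
    exact le_of_mul_le_mul_left this hN
  have hxR : ‖x - x₀‖ ≤ R := by
    refine le_of_sq_le_sq ?_ hR.le
    have : ρ * ‖x - x₀‖ ^ 2 ≤ ρ * R ^ 2 := by
      have : ρ * R ^ 2 = δ := by rw [pow_two, ← mul_assoc, hρR, mul_comm, hRε]
      linarith [hB0 x]
    exact le_of_mul_le_mul_left this hρ
  have hBx : 0 < B x := by linarith [hμle x hxK]
  have hxV : x ∈ V := hV (Metric.mem_closedBall.2 (by rw [dist_eq_norm]; linarith))
  -- comparison with a nearest feasible point bounds the first multiplier
  have hNA' : N * A x ≤ (L + 3) * κ := by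
    obtain ⟨x', hx'C, hx'⟩ := (hC.preimage hf.continuous).exists_infDist_eq_dist ⟨x₀, hx₀⟩ x
    have hd : dist x x' ≤ κ * A x := hx' ▸ hsub x hxV
    have hd' : ‖x' - x‖ ≤ κ * A x := by rwa [← dist_eq_norm, dist_comm]
    have hκA : κ * A x ≤ R := (mul_le_mul_of_nonneg_left hAθ hκ.le).trans hθR
    have htri : ‖x' - x₀‖ ≤ ‖x - x₀‖ + κ * A x := by
      have := norm_add_le (x' - x) (x - x₀)
      rw [sub_add_sub_cancel] at this
      linarith
    have hx'K : x' ∈ Metric.closedBall x₀ (2 * R) := by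
      rw [Metric.mem_closedBall, dist_eq_norm]
      linarith
    have hx'V : x' ∈ V := hV (Metric.closedBall_subset_closedBall h2R.le hx'K)
    have hA' : A x' = 0 := Metric.infDist_zero_of_mem hx'C
    have hB' : B x' ≤ B x + L * (κ * A x) := by
      refine (Metric.infDist_le_infDist_add_dist (y := g x)).trans ?_
      refine add_le_add le_rfl ((hlip x' hx'V x hxV).trans ?_)
      rw [dist_eq_norm]
      gcongr
    -- The increment of the square is at most `(2R + R) κ A x`, and `ρR = ε ≤ 1`; hence the `3` in
    -- `L + 3`.
    have hsq : ρ * ‖x' - x₀‖ ^ 2 ≤ ρ * ‖x - x₀‖ ^ 2 + 3 * (κ * A x) := by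
      have h1 : ‖x' - x₀‖ ^ 2 ≤ (‖x - x₀‖ + κ * A x) ^ 2 := by gcongr
      have hκA0 : 0 ≤ κ * A x := mul_nonneg hκ.le (hA0 x)
      have h2 : (‖x - x₀‖ + κ * A x) ^ 2 ≤ ‖x - x₀‖ ^ 2 + 3 * R * (κ * A x) := by
        nlinarith [mul_le_mul_of_nonneg_right hxR hκA0, mul_le_mul_of_nonneg_right hκA hκA0]
      calc ρ * ‖x' - x₀‖ ^ 2 ≤ ρ * (‖x - x₀‖ ^ 2 + 3 * R * (κ * A x)) :=
            mul_le_mul_of_nonneg_left (h1.trans h2) hρ.le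
        _ = ρ * ‖x - x₀‖ ^ 2 + 3 * (ρ * R) * (κ * A x) := by ring
        _ ≤ ρ * ‖x - x₀‖ ^ 2 + 3 * 1 * (κ * A x) := by
          rw [hρR]
          gcongr
          linarith
        _ = _ := by ring
    have h1 := hmin x' hx'K
    rw [hA'] at h1
    have h2 : N * A x ^ 2 ≤ (L + 3) * κ * A x := by nlinarith
    rcases (hA0 x).eq_or_lt with h0 | h0
    · rw [← h0, mul_zero]
      positivity
    · refine le_of_mul_le_mul_right ?_ h0
      linarith [h2, pow_two (A x), mul_assoc N (A x) (A x)]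
  obtain ⟨y₁, hy₁, hy₁d⟩ := hC.exists_infDist_eq_dist hCne (f x)
  obtain ⟨y₂, hy₂, hy₂d⟩ := hD.exists_infDist_eq_dist hDne (g x)
  have hn1 : ‖f x - y₁‖ = A x := by rw [← dist_eq_norm, ← hy₁d]
  have hn2 : ‖g x - y₂‖ = B x := by rw [← dist_eq_norm, ← hy₂d]
  -- Fixing the nearest points and using `t ≤ t² / (2b) + b / 2` with `b = B x` gives a
  -- differentiable majorant touching the penalty function at `x`.
  have hloc : IsLocalMin (fun u => N * ‖f u - y₁‖ ^ 2 + (1 / (2 * B x)) * ‖g u - y₂‖ ^ 2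
      + ρ * ‖u - x₀‖ ^ 2) x := by
    have hnhds : Metric.closedBall x₀ (2 * R) ∈ 𝓝 x :=
      mem_of_superset (Metric.isOpen_ball.mem_nhds
        (by rw [Metric.mem_ball, dist_eq_norm]; linarith)) Metric.ball_subset_closedBall
    filter_upwards [hnhds] with u hu
    have h1 := hmin u hu
    have h2 : A u ≤ ‖f u - y₁‖ := by
      rw [← dist_eq_norm]; exact Metric.infDist_le_dist_of_mem hy₁
    have h3 : B u ≤ ‖g u - y₂‖ := by
      rw [← dist_eq_norm]; exact Metric.infDist_le_dist_of_mem hy₂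
    have h4 : N * A u ^ 2 ≤ N * ‖f u - y₁‖ ^ 2 := by
      have := hA0 u
      gcongr
    have h5 : ‖g u - y₂‖ ≤ (1 / (2 * B x)) * ‖g u - y₂‖ ^ 2 + B x / 2 := by
      have : (1 / (2 * B x)) * ‖g u - y₂‖ ^ 2 + B x / 2 - ‖g u - y₂‖
          = (‖g u - y₂‖ - B x) ^ 2 / (2 * B x) := by
        field_simp
        ring
      have h6 : 0 ≤ (‖g u - y₂‖ - B x) ^ 2 / (2 * B x) := by positivity
      linarith
    have h7 : (1 / (2 * B x)) * B x ^ 2 = B x / 2 := by field_simp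
    rw [hn1, hn2, h7]
    linarith
  have hgrad := adjoint_add_adjoint_eq_of_isLocalMin (hf.differentiable one_ne_zero x)
    (hg.differentiable one_ne_zero x) hloc
  refine ⟨x, y₁, y₂, (2 * N) • (f x - y₁), (2 * (1 / (2 * B x))) • (g x - y₂), hxR.trans hRΔ,
    smul_sub_mem_regularNormalCone hy₁ hy₁d (by positivity),
    smul_sub_mem_regularNormalCone hy₂ hy₂d (by positivity), ?_, ?_, ?_, ?_, ?_⟩
  · rw [norm_smul, hn2, Real.norm_of_nonneg (by positivity)]
    field_simp
  · rw [norm_smul, hn1, Real.norm_of_nonneg (by positivity)]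
    linarith
  · rw [hn1]
    linarith
  · rw [hn2]
    linarith
  · rw [hgrad, norm_neg, norm_smul, Real.norm_of_nonneg (by positivity)]
    calc 2 * ρ * ‖x - x₀‖ ≤ 2 * ρ * R := by gcongr
      _ = 2 * ε := by rw [mul_assoc, hρR]

end Subregularity

/-- Directions along which the image sequence stays `o(‖x - z‖)`-close to given points. -/
theorem tendsto_inv_smul_sub_of_hasFDerivAt {E F : Type*} [NormedAddCommGroup E] [NormedSpace ℝ E]
    [NormedAddCommGroup F] [NormedSpace ℝ F] {f : E → F} {f' : E →L[ℝ] F} {z w : E}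
    (hf : HasFDerivAt f f' z) {x : ℕ → E} {y : ℕ → F} {ε : ℕ → ℝ} (hx : Tendsto x atTop (𝓝 z))
    (hx0 : ∀ k, 0 < ‖x k - z‖) (hw : Tendsto (fun k => ‖x k - z‖⁻¹ • (x k - z)) atTop (𝓝 w))
    (hε : Tendsto ε atTop (𝓝 0)) (hy : ∀ k, ‖f (x k) - y k‖ ≤ ε k * ‖x k - z‖) :
    Tendsto (fun k => ‖x k - z‖⁻¹ • (y k - f z)) atTop (𝓝 (f' w)) := by
  have h1 : Tendsto (fun k => ‖x k - z‖⁻¹ • (f (x k) - f z - f' (x k - z))) atTop (𝓝 0) := by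
    have := (hasFDerivAt_iff_tendsto.1 hf).comp hx
    rw [tendsto_zero_iff_norm_tendsto_zero]
    simpa [norm_smul, Function.comp_def] using this
  have h2 : Tendsto (fun k => ‖x k - z‖⁻¹ • (f (x k) - y k)) atTop (𝓝 0) := by
    refine squeeze_zero_norm (fun k => ?_) hε
    rw [norm_smul, norm_inv, norm_norm, inv_mul_le_iff₀ (hx0 k), mul_comm]
    exact hy k
  have h3 := ((f'.continuous.tendsto w).comp hw).add (h1.sub h2)
  rw [sub_zero, add_zero] at h3
  refine h3.congr fun k => ?_
  simp only [Function.comp_apply, map_smul, ← smul_sub, ← smul_add]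
  congr 1
  abel

/-! ### From failure of subregularity to exact multipliers. -/

section Subregularity

variable {E F G : Type*} [NormedAddCommGroup E] [InnerProductSpace ℝ E] [FiniteDimensional ℝ E]
  [NormedAddCommGroup F] [InnerProductSpace ℝ F] [FiniteDimensional ℝ F]
  [NormedAddCommGroup G] [InnerProductSpace ℝ G] [FiniteDimensional ℝ G]

/-- If adding the constraint `g u ∈ D` to a subregular constraint `f u ∈ C` destroys subregularity,
then there are approximate multipliers with a normalized part for the new constraint. -/
theorem exists_approximate_multipliers {f : E → F} {g : E → G} {C : Set F} {D : Set G} {z : E}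
    (hf : ContDiff ℝ 1 f) (hg : ContDiff ℝ 1 g) (hC : IsClosed C) (hD : IsClosed D)
    (hzD : g z ∈ D) (hsub : ConstraintMetricallySubregular f C z)
    (hnot : ∀ κ : ℝ, 0 < κ → ∀ V ∈ 𝓝 z, ∃ x ∈ V,
      κ * (Metric.infDist (f x) C + Metric.infDist (g x) D)
        < Metric.infDist x {u | f u ∈ C ∧ g u ∈ D}) :
    ∃ K : ℝ, ∀ ε : ℝ, 0 < ε → ε ≤ 1 / 4 → ∃ (x : E) (y₁ : F) (y₂ : G) (l₁ : F) (l₂ : G),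
      0 < ‖x - z‖ ∧ ‖x - z‖ ≤ ε ∧
      l₁ ∈ regularNormalCone C y₁ ∧ l₂ ∈ regularNormalCone D y₂ ∧
      ‖l₂‖ = 1 ∧ ‖l₁‖ ≤ K ∧
      ‖f x - y₁‖ ≤ ε * ‖x - z‖ ∧ ‖g x - y₂‖ ≤ ε * ‖x - z‖ ∧
      ‖(fderiv ℝ f x).adjoint l₁ + (fderiv ℝ g x).adjoint l₂‖ ≤ 2 * ε := by
  obtain ⟨hzC, κ, hκ, V₁, hV₁, hsub⟩ := hsub
  obtain ⟨L, V₂, hV₂, hlip⟩ := hg.contDiffAt.exists_lipschitzOnWith (x := z)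
  obtain ⟨r, hr, hrV⟩ := Metric.mem_nhds_iff.1 (inter_mem hV₁ hV₂)
  refine ⟨2 * ((L + 3) * κ), fun ε hε hε' => ?_⟩
  set S : Set E := {u | f u ∈ C ∧ g u ∈ D} with hS
  have hzS : z ∈ S := ⟨hzC, hzD⟩
  -- Both `‖x₀ - z‖` and `Δ` will be below `2σ`, so the `Δ`-ball about `x₀` lies within `4σ` of `z`.
  obtain ⟨σ, hσ, hσr, hσε⟩ : ∃ σ : ℝ, 0 < σ ∧ 4 * σ < r ∧ 4 * σ ≤ ε :=
    ⟨min (r / 8) (ε / 4), by positivity, by linarith [min_le_left (r / 8) (ε / 4)],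
      by linarith [min_le_right (r / 8) (ε / 4)]⟩
  have hL : (0 : ℝ) ≤ L := L.2
  -- The summand `κ` pays for projecting `x` onto `f⁻¹(C)`; the rest makes the `g`-residual at the
  -- projection at most `ε²Δ`.
  obtain ⟨x, hx, hlt⟩ := hnot (κ + (1 + L * κ) / ε ^ 2) (by positivity) _ (Metric.ball_mem_nhds z hσ)
  have hα : 0 ≤ Metric.infDist (f x) C := Metric.infDist_nonneg
  have hβ : 0 ≤ Metric.infDist (g x) D := Metric.infDist_nonneg
  set α := Metric.infDist (f x) C
  set β := Metric.infDist (g x) D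
  have hxz : dist x z < σ := hx
  have hxr : x ∈ Metric.ball z r := Metric.mem_ball.2 (by linarith)
  obtain ⟨x₀, hx₀C, hx₀⟩ := (hC.preimage hf.continuous).exists_infDist_eq_dist ⟨z, hzC⟩ x
  have hd : dist x x₀ ≤ κ * α := hx₀ ▸ hsub x (hrV hxr).1
  have hdz : dist x x₀ ≤ dist x z := hx₀ ▸ Metric.infDist_le_dist_of_mem hzC
  have hx₀z : dist x₀ z < 2 * σ := by
    have := dist_triangle_left x₀ z x
    linarith
  have hΔx : Metric.infDist x S ≤ Metric.infDist x₀ S + dist x x₀ :=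
    Metric.infDist_le_infDist_add_dist
  have hq : 0 ≤ (1 + L * κ) / ε ^ 2 * (α + β) := by positivity
  set Δ := Metric.infDist x₀ S with hΔ_def
  have hlt' : (1 + L * κ) / ε ^ 2 * (α + β) < Δ := by nlinarith
  have hΔ : 0 < Δ := hq.trans_lt hlt'
  have hΔz : Δ ≤ dist x₀ z := Metric.infDist_le_dist_of_mem hzS
  have hx₀r : x₀ ∈ Metric.ball z r := Metric.mem_ball.2 (by linarith)
  have hsmall : Metric.infDist (g x₀) D ≤ ε ^ 2 * Δ := by
    have h1 : Metric.infDist (g x₀) D ≤ β + dist (g x₀) (g x) :=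
      Metric.infDist_le_infDist_add_dist
    have h2 : dist (g x₀) (g x) ≤ L * (κ * α) := by
      refine (hlip.dist_le_mul _ (hrV hx₀r).2 _ (hrV hxr).2).trans ?_
      rw [dist_comm]
      gcongr
    have h3 : (1 + L * κ) * (α + β) ≤ ε ^ 2 * Δ := by
      have := mul_le_mul_of_nonneg_left hlt'.le (sq_nonneg ε)
      rwa [← mul_assoc, mul_div_cancel₀ _ (by positivity : ε ^ 2 ≠ 0)] at this
    have h4 : 0 ≤ L * κ * β := by positivity
    nlinarith
  obtain ⟨u, y₁, y₂, l₁, l₂, hu, hl₁, hl₂, hn₂, hn₁, hy₁, hy₂, hadj⟩ :=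
    exists_penalty_multipliers (V := Metric.ball z r) hf hg hC hD hκ hL
      (fun x hx => hsub x (hrV hx).1)
      (fun x hx y hy => hlip.dist_le_mul _ (hrV hx).2 _ (hrV hy).2) hε hε' hx₀C ⟨_, hzD⟩
      (fun v hv => Metric.mem_ball.2 (by
        have := dist_triangle v x₀ z
        have := Metric.mem_closedBall.1 hv
        linarith)) hΔ
      (fun v hv hvS => by
        have := Metric.infDist_le_dist_of_mem (x := x₀) (s := S) hvS
        rw [dist_comm] at this
        linarith) hsmall
  rw [dist_eq_norm] at hΔz hx₀z
  have hεΔ : ε * Δ ≤ Δ / 4 := by nlinarith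
  have htri₁ : ‖u - z‖ ≤ ‖u - x₀‖ + ‖x₀ - z‖ := by
    simpa using norm_add_le (u - x₀) (x₀ - z)
  have htri₂ : ‖x₀ - z‖ ≤ ‖u - x₀‖ + ‖u - z‖ := by
    simpa using norm_sub_le (u - z) (u - x₀) |>.trans_eq (add_comm _ _)
  -- Feasibility of `z` gives `Δ ≤ ‖x₀ - z‖`, and `u` moves at most `Δ / 4`. This turns errors `ε²Δ`
  -- into `ε‖u - z‖`, the scale needed for directional limits.
  have hlow : ε * Δ ≤ ‖u - z‖ := by linarith
  have hsq : ε ^ 2 * Δ ≤ ε * ‖u - z‖ := by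
    rw [pow_two, mul_assoc]
    gcongr
  exact ⟨u, y₁, y₂, l₁, l₂, (by positivity : 0 < ε * Δ).trans_le hlow, by linarith, hl₁, hl₂, hn₂,
    hn₁, hy₁.trans hsq, hy₂.trans hsq, hadj⟩

/-- Normalized displacements and multipliers are bounded, so a subsequence converges. Unit norms
survive in the limit, and `o(‖x - z‖)` residuals give the points `y₁`, `y₂` the directions `∇f(z)w`,
`∇g(z)w`. -/
theorem exists_multipliers_of_approximate {f : E → F} {g : E → G} {C : Set F} {D : Set G} {z : E}
    (hf : ContDiff ℝ 1 f) (hg : ContDiff ℝ 1 g) {K : ℝ}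
    (h : ∀ ε : ℝ, 0 < ε → ε ≤ 1 / 4 → ∃ (x : E) (y₁ : F) (y₂ : G) (l₁ : F) (l₂ : G),
      0 < ‖x - z‖ ∧ ‖x - z‖ ≤ ε ∧
      l₁ ∈ regularNormalCone C y₁ ∧ l₂ ∈ regularNormalCone D y₂ ∧
      ‖l₂‖ = 1 ∧ ‖l₁‖ ≤ K ∧
      ‖f x - y₁‖ ≤ ε * ‖x - z‖ ∧ ‖g x - y₂‖ ≤ ε * ‖x - z‖ ∧
      ‖(fderiv ℝ f x).adjoint l₁ + (fderiv ℝ g x).adjoint l₂‖ ≤ 2 * ε) :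
    ∃ w : E, w ≠ 0 ∧ ∃ (l₁ : F) (l₂ : G), l₂ ≠ 0 ∧
      l₁ ∈ directionalNormalCone C (f z) (fderiv ℝ f z w) ∧
      l₂ ∈ directionalNormalCone D (g z) (fderiv ℝ g z w) ∧
      (fderiv ℝ f z).adjoint l₁ + (fderiv ℝ g z).adjoint l₂ = 0 := by
  have hpos : ∀ k : ℕ, (0 : ℝ) < 1 / ((k : ℝ) + 4) := fun k => by positivity
  have hle : ∀ k : ℕ, 1 / ((k : ℝ) + 4) ≤ 1 / 4 := fun k =>
    one_div_le_one_div_of_le (by norm_num) (by linarith [Nat.cast_nonneg (α := ℝ) k])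
  choose x y₁ y₂ l₁ l₂ hx0 hxε hl₁ hl₂ hn₂ hn₁ hy₁ hy₂ hadj using
    fun k : ℕ => h (1 / ((k : ℝ) + 4)) (hpos k) (hle k)
  have hε : Tendsto (fun k : ℕ => 1 / ((k : ℝ) + 4)) atTop (𝓝 0) :=
    (tendsto_const_nhds.div_atTop
      (tendsto_atTop_add_const_right _ _ tendsto_natCast_atTop_atTop))
  have hx : Tendsto x atTop (𝓝 z) := by
    rw [tendsto_iff_norm_sub_tendsto_zero]
    exact squeeze_zero (fun k => norm_nonneg _) hxε hε
  have hnw : ∀ k, ‖‖x k - z‖⁻¹ • (x k - z)‖ = 1 := fun k => by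
    rw [norm_smul, norm_inv, norm_norm, inv_mul_cancel₀ (hx0 k).ne']
  obtain ⟨⟨w, m₁, m₂⟩, -, φ, hφ, hlim⟩ := tendsto_subseq_of_bounded
    (s := Metric.closedBall (0 : E) 1 ×ˢ Metric.closedBall (0 : F) K ×ˢ Metric.closedBall (0 : G) 1)
    (Metric.isBounded_closedBall.prod
      (Metric.isBounded_closedBall.prod Metric.isBounded_closedBall))
    (x := fun k => (‖x k - z‖⁻¹ • (x k - z), l₁ k, l₂ k))
    (fun k => ⟨by simpa using (hnw k).le, by simpa using hn₁ k, by simpa using (hn₂ k).le⟩)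
  have hw := (continuous_fst.tendsto _).comp hlim
  have hm₁ := (continuous_fst.tendsto _).comp ((continuous_snd.tendsto _).comp hlim)
  have hm₂ := (continuous_snd.tendsto _).comp ((continuous_snd.tendsto _).comp hlim)
  have hxφ := hx.comp hφ.tendsto_atTop
  have hεφ := hε.comp hφ.tendsto_atTop
  have ht0 : Tendsto (fun k => ‖x (φ k) - z‖) atTop (𝓝 0) :=
    tendsto_iff_norm_sub_tendsto_zero.1 hxφ
  have hw1 : ‖w‖ = 1 := tendsto_nhds_unique hw.norm
    (tendsto_const_nhds.congr fun k => (hnw (φ k)).symm)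
  have hm1 : ‖m₂‖ = 1 := tendsto_nhds_unique hm₂.norm
    (tendsto_const_nhds.congr fun k => (hn₂ (φ k)).symm)
  refine ⟨w, norm_ne_zero_iff.1 (by simp [hw1]), m₁, m₂, norm_ne_zero_iff.1 (by simp [hm1]),
    ⟨fun k => ‖x (φ k) - z‖, fun k => ‖x (φ k) - z‖⁻¹ • (y₁ (φ k) - f z), fun k => l₁ (φ k),
      fun k => hx0 _, ht0, ?_, hm₁, fun k => ?_⟩,
    ⟨fun k => ‖x (φ k) - z‖, fun k => ‖x (φ k) - z‖⁻¹ • (y₂ (φ k) - g z), fun k => l₂ (φ k),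
      fun k => hx0 _, ht0, ?_, hm₂, fun k => ?_⟩, ?_⟩
  · exact tendsto_inv_smul_sub_of_hasFDerivAt (hf.differentiable one_ne_zero z).hasFDerivAt hxφ
      (fun k => hx0 _) hw hεφ fun k => hy₁ _
  · simpa [smul_inv_smul₀ (hx0 (φ k)).ne'] using hl₁ (φ k)
  · exact tendsto_inv_smul_sub_of_hasFDerivAt (hg.differentiable one_ne_zero z).hasFDerivAt hxφ
      (fun k => hx0 _) hw hεφ fun k => hy₂ _
  · simpa [smul_inv_smul₀ (hx0 (φ k)).ne'] using hl₂ (φ k)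
  · have hA : Tendsto (fun k => (fderiv ℝ f (x (φ k))).adjoint) atTop
        (𝓝 (fderiv ℝ f z).adjoint) :=
      ((ContinuousLinearMap.adjoint.continuous.comp
        (hf.continuous_fderiv one_ne_zero)).tendsto z).comp hxφ
    have hB : Tendsto (fun k => (fderiv ℝ g (x (φ k))).adjoint) atTop
        (𝓝 (fderiv ℝ g z).adjoint) :=
      ((ContinuousLinearMap.adjoint.continuous.comp
        (hg.continuous_fderiv one_ne_zero)).tendsto z).comp hxφ
    have h1 := ((isBoundedBilinearMap_apply.continuous.tendsto (_, m₁)).comp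
      (hA.prodMk_nhds hm₁)).add ((isBoundedBilinearMap_apply.continuous.tendsto (_, m₂)).comp
      (hB.prodMk_nhds hm₂))
    refine tendsto_nhds_unique h1 (squeeze_zero_norm (fun k => hadj (φ k)) ?_)
    simpa using hεφ.const_mul 2

/-- Adding a constraint to a subregular one keeps subregularity under a directional multiplier
condition on the added constraint. -/
theorem subregular_inter_of_multiplierCondition {f : E → F} {g : E → G} {C : Set F} {D : Set G}
    {z : E} (hf : ContDiff ℝ 1 f) (hg : ContDiff ℝ 1 g) (hC : IsClosed C) (hD : IsClosed D)
    (hzD : g z ∈ D) (hsub : ConstraintMetricallySubregular f C z)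
    (h : ∀ w : E, w ≠ 0 → ∀ (l₁ : F) (l₂ : G),
      l₁ ∈ directionalNormalCone C (f z) (fderiv ℝ f z w) →
      l₂ ∈ directionalNormalCone D (g z) (fderiv ℝ g z w) →
      (fderiv ℝ f z).adjoint l₁ + (fderiv ℝ g z).adjoint l₂ = 0 → l₂ = 0) :
    ∃ κ : ℝ, 0 < κ ∧ ∃ V ∈ 𝓝 z, ∀ x ∈ V, Metric.infDist x {u | f u ∈ C ∧ g u ∈ D}
      ≤ κ * (Metric.infDist (f x) C + Metric.infDist (g x) D) := by
  by_contra! hnot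
  obtain ⟨K, hK⟩ := exists_approximate_multipliers hf hg hC hD hzD hsub hnot
  obtain ⟨w, hw, l₁, l₂, hl, h₁, h₂, hadj⟩ := exists_multipliers_of_approximate hf hg hK
  exact hl (h w hw l₁ l₂ h₁ h₂ hadj)

end Subregularity

/-! ### Assembly of the block system. -/

theorem subregular_jointMap_of_multiplierCondition {n m : ℕ} {s : Fin (m + 1) → ℕ}
    {P : ∀ i, EuclideanSpace ℝ (Fin n) → EuclideanSpace ℝ (Fin (s i))}
    {D : ∀ i, Set (EuclideanSpace ℝ (Fin (s i)))} {z : EuclideanSpace ℝ (Fin n)}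
    (hP : ∀ i, ContDiff ℝ 1 (P i)) (hD : ∀ i, IsClosed (D i))
    (hz : jointMap P z ∈ euclideanPi D) (hsub : ConstraintMetricallySubregular (P 0) (D 0) z)
    (h : BlockwiseMultiplierCondition P D z) :
    ConstraintMetricallySubregular (jointMap P) (euclideanPi D) z := by
  have hP' : ∀ i : Fin m, ContDiff ℝ 1 (P i.succ) := fun i => hP i.succ
  obtain ⟨κ, hκ, V, hV, hVκ⟩ := subregular_inter_of_multiplierCondition (hP 0)
    (contDiff_jointMap hP') (hD 0) (isClosed_euclideanPi fun i : Fin m => hD i.succ)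
    (fun i => hz i.succ) hsub (fun w hw l₁ l₂ h₁ h₂ hadj => by
      obtain ⟨l, rfl, hl⟩ : ∃ l : ∀ i, EuclideanSpace ℝ (Fin (s i)),
          l 0 = l₁ ∧ ∀ j : Fin m, l j.succ = l₂ j := ⟨Fin.cons l₁ fun j => l₂ j, rfl, fun _ => rfl⟩
      have hN : ∀ i, l i ∈ directionalNormalCone (D i) (P i z) (fderiv ℝ (P i) z w) := fun i => by
        refine Fin.cases h₁ (fun j => ?_) i
        have := directionalNormalCone_euclideanPi_subset h₂ j
        rwa [fderiv_jointMap_apply hP', ← hl] at this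
      simp only [adjoint_fderiv_jointMap hP', ← hl] at hadj
      ext1 j
      rw [← hl]
      exact h w hw (fun i => mem_bouligandTangentCone_of_mem_directionalNormalCone (hN i)) l hadj
        hN j)
  -- The factor `2` arises because the first and the remaining residuals are each at most the joint
  -- one.
  refine ⟨hz, 2 * κ, by positivity, V, hV, fun x hx => ?_⟩
  have hset : {u | P 0 u ∈ D 0 ∧
      jointMap (fun i : Fin m => P i.succ) u ∈ euclideanPi fun i : Fin m => D i.succ}
      = {u | jointMap P u ∈ euclideanPi D} := by
    ext u
    exact (Fin.forall_fin_succ (P := fun i => P i u ∈ D i)).symm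
  have h1 := hVκ x hx
  rw [hset] at h1
  have h2 := infDist_apply_le_infDist_euclideanPi ⟨_, hz⟩ (jointMap P x) 0
  have h3 := infDist_tail_le_infDist_euclideanPi ⟨_, hz⟩ (jointMap P x)
  calc _ ≤ _ := h1
    _ ≤ κ * (Metric.infDist (jointMap P x) (euclideanPi D)
        + Metric.infDist (jointMap P x) (euclideanPi D)) :=
      mul_le_mul_of_nonneg_left (add_le_add h2 h3) hκ.le
    _ = _ := by ring

theorem mainTheorem7 {n m : ℕ} {s : Fin (m + 1) → ℕ}
    (P : ∀ i, EuclideanSpace ℝ (Fin n) → EuclideanSpace ℝ (Fin (s i)))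
    (D : ∀ i, Set (EuclideanSpace ℝ (Fin (s i))))
    (z : EuclideanSpace ℝ (Fin n))
    (hP : ∀ i, ContDiff ℝ 1 (P i))
    (hD : ∀ i, IsClosed (D i))
    (hz : jointMap P z ∈ euclideanPi D) :
    (ConstraintMetricallySubregular (P 0) (D 0) z → BlockwiseMultiplierCondition P D z →
      ConstraintMetricallySubregular (jointMap P) (euclideanPi D) z) ∧
    ((∀ i : Fin m, DirectionallyRegularAt (D i.succ) (P i.succ z)) →
      (BlockwiseMultiplierCondition P D z ↔ JointMultiplierCondition P D z)) :=
  ⟨subregular_jointMap_of_multiplierCondition hP hD hz, multiplierCondition_iff hP⟩
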